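/- Let $d\ge 1$, let $\sigma^2>0$ be known, and let $X\sim N_d(\theta,\sigma^2 I_d)$ with unknown $\theta\in\mathbb{R}^d$. Let $\beta:[0,\infty)\to[0,\infty)$ be strictly increasing and absolutely continuous on every interval $[0,b]$, let $Z\sim\chi^2_d$, and assume $\mathbb{E}\,\beta(Z)<\infty$. The quantity to be estimated is the first-stage loss $$L=\beta\Big(\frac{\|X-\theta\|^2}{\sigma^2}\Big)$$ incurred when $X$ is used to estimate $\theta$. A loss estimator is a measurable function $\hat L:\mathbb{R}^d\to(0,\infty)$. For a second-stage loss $\rho(\hat L/L)$ its risk is $R(\theta,\hat L)=\mathbb{E}_\theta\,\rho(\hat L(X)/L)\in[0,\infty]$; the minimax risk is $\inf_{\hat L}\sup_\theta R(\theta,\hat L)$, over all loss estimators, and $\hat L$ is minimax if $\sup_\theta R(\theta,\hat L)$ equals it. A generalized Bayes estimator with respect to the uniform prior density $\pi_0(\theta)=1$ is a loss estimator $\hat L$ such that, for every $x$, the value $\hat L(x)$ minimizes over $l>0$ the expected posterior loss $\mathbb{E}(\rho(l/L)\mid x)$, the posterior density of $\theta$ given $x$ being proportional to the $N_d(\theta,\sigma^2I_d)$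 density at $x$. Consider one of the following three cases. * (A) $\rho_A(t)=(t^m-1)^2$ with $m\in\mathbb{R}$, $m\neq0$, assuming $\mathbb{E}\,\beta(Z)^{-2m}<\infty$. Put $$c=\Big\{\frac{\mathbb{E}\,\beta(Z)^{-m}}{\mathbb{E}\,\beta(Z)^{-2m}}\Big\}^{1/m},\qquad \bar R=1-\frac{(\mathbb{E}\,\beta(Z)^{-m})^2}{\mathbb{E}\,\beta(Z)^{-2m}}.$$ * (B) $\rho_B(t)=\tfrac12\big(t+\tfrac1t-2\big)$, assuming $\mathbb{E}\,\frac1{\beta(Z)}<\infty$. Put $$c=\sqrt{\frac{\mathbb{E}\,\beta(Z)}{\mathbb{E}\,\frac1{\beta(Z)}}},\qquad \bar R=\sqrt{\mathbb{E}\,\beta(Z)\;\mathbb{E}\tfrac1{\beta(Z)}}-1.$$ * (C) $\rho_C(t)=(\log t)^2$, assuming $\mathbb{E}\,(\log\beta(Z))^2<\infty$. Put $$c=e^{\mathbb{E}\log\beta(Z)},\qquad \bar R=\operatorname{Var}(\log\beta(Z)).$$ Then the constant estimator $\hat L_{\pi_0}(X)=c$ is the unique generalized Bayes estimator of $L$ with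 respect to the uniform prior, its risk satisfies $R(\theta,\hat L_{\pi_0})=\bar R$ for every $\theta$, it is minimax, and the minimax risk is $\bar R$. -/

import Mathlib

open MeasureTheory ProbabilityTheory Set
open scoped ENNReal

noncomputable section

namespace LossEstimation

/-- The sampling model `X ∼ N_d(θ, σ² I_d)`. -/
def normalModel (d : ℕ) (σ : ℝ) (θ : EuclideanSpace ℝ (Fin d)) :
    Measure (EuclideanSpace ℝ (Fin d)) :=
  multivariateGaussian θ (σ ^ 2 • (1 : Matrix (Fin d) (Fin d) ℝ))

/-- The Lebesgue density `f_θ(x) = (2πσ²)^(-d/2) exp(-‖x - θ‖² / (2σ²))` of `N_d(θ, σ² I_d)`. -/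
def normalDensity (d : ℕ) (σ : ℝ) (θ x : EuclideanSpace ℝ (Fin d)) : ℝ :=
  (2 * Real.pi * σ ^ 2) ^ (-(d : ℝ) / 2) * Real.exp (-‖x - θ‖ ^ 2 / (2 * σ ^ 2))

/-- The central chi-square law `χ²_d`: the law of `‖G‖²` for a standard Gaussian vector `G` in
dimension `d`, i.e. of the sum of the squares of `d` independent standard normal variables. -/
def chiSquare (d : ℕ) : Measure ℝ :=
  (stdGaussian (EuclideanSpace ℝ (Fin d))).map (fun z => ‖z‖ ^ 2)

/-- The first-stage loss `L = β(‖x - θ‖² / σ²)` incurred by `θ̂₀(x) = x`. -/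
def firstLoss (d : ℕ) (σ : ℝ) (β : ℝ → ℝ) (θ x : EuclideanSpace ℝ (Fin d)) : ℝ :=
  β (‖x - θ‖ ^ 2 / σ ^ 2)

/-- The second-stage loss `W(L, l) = ρ(l / L)`, as an element of `[0, ∞]`. -/
def secondLoss (ρ : ℝ → ℝ) (L l : ℝ) : ℝ≥0∞ :=
  ENNReal.ofReal (ρ (l / L))

/-- `ρ_A(t) = (t^m - 1)²`. -/
def rhoA (m t : ℝ) : ℝ := (t ^ m - 1) ^ 2

/-- `ρ_B(t) = (t + 1/t - 2) / 2`. -/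
def rhoB (t : ℝ) : ℝ := (1 / 2) * (t + 1 / t - 2)

/-- `ρ_C(t) = (log t)²`. -/
def rhoC (t : ℝ) : ℝ := (Real.log t) ^ 2

/-- Estimators of the loss: measurable functions of the observation with values in `(0, ∞)`. -/
def IsLossEstimator {d : ℕ} (δ : EuclideanSpace ℝ (Fin d) → ℝ) : Prop :=
  Measurable δ ∧ ∀ x, 0 < δ x

/-- The frequentist risk `R(θ, δ) = E_θ W(L, δ(X))`, in `[0, ∞]`. -/
def risk (d : ℕ) (σ : ℝ) (β ρ : ℝ → ℝ) (δ : EuclideanSpace ℝ (Fin d) → ℝ)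
    (θ : EuclideanSpace ℝ (Fin d)) : ℝ≥0∞ :=
  ∫⁻ x, secondLoss ρ (firstLoss d σ β θ x) (δ x) ∂(normalModel d σ θ)

/-- The minimax risk `inf_δ sup_θ R(θ, δ)`, the infimum being over all loss estimators. -/
def minimaxRisk (d : ℕ) (σ : ℝ) (β ρ : ℝ → ℝ) : ℝ≥0∞ :=
  ⨅ (δ : EuclideanSpace ℝ (Fin d) → ℝ) (_ : IsLossEstimator δ), ⨆ θ, risk d σ β ρ δ θ

/-- `δ` is minimax: it is a loss estimator and its maximal risk equals the minimax risk. -/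
def IsMinimax (d : ℕ) (σ : ℝ) (β ρ : ℝ → ℝ) (δ : EuclideanSpace ℝ (Fin d) → ℝ) : Prop :=
  IsLossEstimator δ ∧ (⨆ θ, risk d σ β ρ δ θ) = minimaxRisk d σ β ρ

/-- The (formal) posterior law of `θ` given `x` for a possibly improper prior `π`: the measure
with `π`-density `f_θ(x) / ∫ f_t(x) π(dt)`. -/
def posterior (d : ℕ) (σ : ℝ) (π : Measure (EuclideanSpace ℝ (Fin d)))
    (x : EuclideanSpace ℝ (Fin d)) : Measure (EuclideanSpace ℝ (Fin d)) :=
  (∫⁻ t, ENNReal.ofReal (normalDensity d σ t x) ∂π)⁻¹ •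
    π.withDensity (fun θ => ENNReal.ofReal (normalDensity d σ θ x))

/-- The expected posterior loss `E(W(L, l) | x)` of the estimate `l` of `L`. -/
def posteriorLoss (d : ℕ) (σ : ℝ) (β ρ : ℝ → ℝ) (π : Measure (EuclideanSpace ℝ (Fin d)))
    (x : EuclideanSpace ℝ (Fin d)) (l : ℝ) : ℝ≥0∞ :=
  ∫⁻ θ, secondLoss ρ (firstLoss d σ β θ x) l ∂(posterior d σ π x)

/-- `δ` is a (generalized) Bayes estimator of the loss for the prior `π`: for every `x`, the
estimate `δ x` minimizes the expected posterior loss among all `l > 0`. -/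
def IsGeneralizedBayes (d : ℕ) (σ : ℝ) (β ρ : ℝ → ℝ) (π : Measure (EuclideanSpace ℝ (Fin d)))
    (δ : EuclideanSpace ℝ (Fin d) → ℝ) : Prop :=
  IsLossEstimator δ ∧
    ∀ x l, 0 < l → posteriorLoss d σ β ρ π x (δ x) ≤ posteriorLoss d σ β ρ π x l

end LossEstimation

end

namespace LossEstimation

open Filter Topology

variable {d : ℕ} {σ : ℝ} {β ρ : ℝ → ℝ}

/-! The problem is translation invariant. The error `u = x - θ` has law `N(0, σ² I)` whatever `θ`
is, and under the uniform prior the posterior of `θ` is the law of `x - u` (`posterior_volume`).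
Hence the posterior loss of `l`, for every `x`, and the risk of the constant `l`, for every `θ`, are
the same number `h(l) = E ρ(l / L(u))`. A strict minimizer `c` of `h` is therefore the unique
generalized Bayes estimator and has constant risk `h(c)`.

The minimax lower bound comes from averaging the risk over a ball of radius `K` (`le_iSup_risk`).
Fubini and the substitution `x = θ + u` bring in integrals over `u` with `x` fixed, where any
estimator is just a constant. Keeping only `‖u‖ ≤ M` and `‖x‖ ≤ K - M` loses a volume factor tending
to 1 as `K → ∞`, so the maximal risk is at least the infimum over `l` of the truncated `h`. It
remains that these truncated infima have lower bounds tending to `h(c)` as `M → ∞`. The bounds are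
explicit: completing the square for `ρ_A` and `ρ_C` (`bayes_minimax_of_quadratic`), AM-GM for `ρ_B`
(`bayes_minimax_rhoB`). -/

lemma normalModel_eq_map_add (θ : EuclideanSpace ℝ (Fin d)) :
    normalModel d σ θ = (normalModel d σ 0).map (fun u => θ + u) := by
  unfold normalModel multivariateGaussian
  rw [Measure.map_map (by fun_prop) (by fun_prop)]
  congr 1
  ext x : 1
  simp

instance isProbabilityMeasure_normalModel (θ : EuclideanSpace ℝ (Fin d)) :
    IsProbabilityMeasure (normalModel d σ θ) := by
  unfold normalModel
  infer_instance

/-! ### Characteristic function, scaling and squared norm of the error. -/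

lemma charFun_normalModel_zero (t : EuclideanSpace ℝ (Fin d)) :
    charFun (normalModel d σ 0) t = Complex.exp (-(σ ^ 2 * ‖t‖ ^ 2) / 2) := by
  unfold normalModel
  rw [charFun_multivariateGaussian (Matrix.PosSemidef.one.smul (sq_nonneg σ))]
  congr 1
  simp only [inner_zero_right, Complex.ofReal_zero, zero_mul, zero_sub, Matrix.smul_mulVec,
    Matrix.one_mulVec, dotProduct_smul, smul_eq_mul]
  rw [← Complex.ofReal_pow ‖t‖, EuclideanSpace.real_norm_sq_eq]
  simp [dotProduct, sq, neg_div]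

lemma normalModel_zero_eq_map_smul :
    normalModel d σ 0 = (stdGaussian (EuclideanSpace ℝ (Fin d))).map (fun u => σ • u) := by
  have : IsProbabilityMeasure
      ((stdGaussian (EuclideanSpace ℝ (Fin d))).map (fun u => σ • u)) :=
    Measure.isProbabilityMeasure_map (by fun_prop)
  apply Measure.ext_of_charFun
  ext t
  rw [charFun_normalModel_zero, charFun_map_smul, charFun_stdGaussian, norm_smul]
  congr 1
  simp only [Real.norm_eq_abs, Complex.ofReal_mul, mul_pow, ← Complex.ofReal_pow, sq_abs]

lemma chiSquare_eq_map (hσ : 0 < σ) :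
    chiSquare d = (normalModel d σ 0).map (fun u => ‖u‖ ^ 2 / σ ^ 2) := by
  rw [normalModel_zero_eq_map_smul, Measure.map_map (by fun_prop) (by fun_prop), chiSquare]
  congr 1
  ext u
  simp only [Function.comp, norm_smul, Real.norm_eq_abs, mul_pow, sq_abs]
  field_simp

/-! ### The Gaussian density and the posterior under the uniform prior. -/

@[fun_prop]
lemma continuous_normalDensity (θ : EuclideanSpace ℝ (Fin d)) :
    Continuous (normalDensity d σ θ) := by
  unfold normalDensity
  fun_prop

lemma normalDensity_nonneg (θ x : EuclideanSpace ℝ (Fin d)) : 0 ≤ normalDensity d σ θ x := by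
  unfold normalDensity
  positivity

lemma normalDensity_eq_sub (θ x : EuclideanSpace ℝ (Fin d)) :
    normalDensity d σ θ x = normalDensity d σ 0 (x - θ) := by
  simp [normalDensity]

/-- A Gaussian integral with an imaginary linear term. It identifies the law with its density, and
`t = 0` gives the normalization. -/
lemma integral_normalDensity_mul_cexp (hσ : 0 < σ) (t : EuclideanSpace ℝ (Fin d)) :
    ∫ v, (normalDensity d σ 0 v : ℂ) * Complex.exp (inner ℝ v t * Complex.I) =
      Complex.exp (-(σ ^ 2 * ‖t‖ ^ 2) / 2) := by
  have hb : (0 : ℝ) < ((1 / (2 * σ ^ 2) : ℝ) : ℂ).re := by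
    rw [Complex.ofReal_re]; positivity
  have h := GaussianFourier.integral_cexp_neg_mul_sq_norm_add hb Complex.I t
  have hσ' : (σ : ℂ) ≠ 0 := by exact_mod_cast hσ.ne'
  have h1 : ∀ v : EuclideanSpace ℝ (Fin d),
      (normalDensity d σ 0 v : ℂ) * Complex.exp (inner ℝ v t * Complex.I) =
      (((2 * Real.pi * σ ^ 2) ^ (-(d : ℝ) / 2) : ℝ) : ℂ) *
        Complex.exp (-((1 / (2 * σ ^ 2) : ℝ) : ℂ) * ‖v‖ ^ 2 + Complex.I * inner ℝ t v) := by
    intro v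
    rw [Complex.exp_add, normalDensity, Complex.ofReal_mul, Complex.ofReal_exp, mul_assoc,
      real_inner_comm]
    congr 3
    · push_cast
      rw [sub_zero]
      ring
    · ring
  simp_rw [h1]
  rw [integral_const_mul, h, ← mul_assoc]
  have h2 : (((2 * Real.pi * σ ^ 2) ^ (-(d : ℝ) / 2) : ℝ) : ℂ) *
      ((Real.pi : ℂ) / ((1 / (2 * σ ^ 2) : ℝ) : ℂ)) ^
        ((Module.finrank ℝ (EuclideanSpace ℝ (Fin d)) : ℂ) / 2) = 1 := by
    have : ((Real.pi : ℂ) / ((1 / (2 * σ ^ 2) : ℝ) : ℂ)) ^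
        ((Module.finrank ℝ (EuclideanSpace ℝ (Fin d)) : ℂ) / 2) =
        (((2 * Real.pi * σ ^ 2) ^ ((d : ℝ) / 2) : ℝ) : ℂ) := by
      rw [Complex.ofReal_cpow (by positivity)]
      congr 1
      · push_cast
        field_simp
      · simp
    rw [this, ← Complex.ofReal_mul, ← Real.rpow_add (by positivity)]
    simp [neg_div]
  rw [h2, one_mul]
  congr 1
  push_cast
  field_simp
  rw [Complex.I_sq]
  ring

lemma integrable_normalDensity (hσ : 0 < σ) :
    Integrable (normalDensity d σ 0) (volume : Measure (EuclideanSpace ℝ (Fin d))) := by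
  have h := integral_normalDensity_mul_cexp (d := d) hσ 0
  simp only [inner_zero_right, Complex.ofReal_zero, zero_mul, Complex.exp_zero, mul_one,
    norm_zero] at h
  rw [integral_complex_ofReal] at h
  -- A non-integrable function would have Bochner integral 0, whereas the transform at `t = 0` is 1.
  refine Integrable.of_integral_ne_zero fun h0 => ?_
  rw [h0] at h
  simp at h

lemma normalModel_zero_eq_withDensity (hσ : 0 < σ) :
    normalModel d σ 0 = volume.withDensity (fun x => ENNReal.ofReal (normalDensity d σ 0 x)) := by
  have : IsFiniteMeasure ((volume : Measure (EuclideanSpace ℝ (Fin d))).withDensity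
      (fun x => ENNReal.ofReal (normalDensity d σ 0 x))) :=
    isFiniteMeasure_withDensity_ofReal (integrable_normalDensity hσ).2
  apply Measure.ext_of_charFun
  ext t
  rw [charFun_normalModel_zero, charFun_apply,
    integral_withDensity_eq_integral_toReal_smul (by fun_prop) (by simp),
    ← integral_normalDensity_mul_cexp hσ t]
  congr 1
  ext v
  rw [ENNReal.toReal_ofReal (normalDensity_nonneg _ _), Complex.real_smul]

/-- The density depends only on `x - θ`, and the reflection `θ ↦ x - θ` preserves Lebesgue measure;
in particular the normalizing constant is 1. -/
lemma posterior_volume (hσ : 0 < σ) (x : EuclideanSpace ℝ (Fin d)) :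
    posterior d σ volume x = (normalModel d σ 0).map (fun u => x - u) := by
  have key : (volume : Measure (EuclideanSpace ℝ (Fin d))).withDensity
      (fun θ => ENNReal.ofReal (normalDensity d σ θ x)) =
      (normalModel d σ 0).map (fun u => x - u) := by
    have hmeas : Measurable fun θ : EuclideanSpace ℝ (Fin d) =>
        ENNReal.ofReal (normalDensity d σ θ x) := by
      unfold normalDensity
      fun_prop
    refine Measure.ext_of_lintegral _ fun f hf => ?_
    rw [lintegral_map hf (by fun_prop), normalModel_zero_eq_withDensity hσ,
      lintegral_withDensity_eq_lintegral_mul _ hmeas hf,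
      lintegral_withDensity_eq_lintegral_mul _ (by fun_prop) (by fun_prop),
      ← lintegral_sub_left_eq_self _ x]
    refine lintegral_congr fun u => ?_
    simp only [Pi.mul_apply]
    rw [normalDensity_eq_sub (x - u) x, sub_sub_cancel]
  have hone : ∫⁻ t, ENNReal.ofReal (normalDensity d σ t x) = 1 := by
    have h := congrArg (fun μ => μ univ) key
    simp only [withDensity_apply _ MeasurableSet.univ, Measure.restrict_univ] at h
    rw [h, Measure.map_apply (by fun_prop) MeasurableSet.univ]
    simp
  rw [posterior, hone, inv_one, one_smul, key]

/-! ### Reduction of risk and posterior loss to the error law. -/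

/-- The first-stage loss as a function of the estimation error `u = x - θ`. -/
noncomputable def errorLoss (σ : ℝ) (β : ℝ → ℝ) (u : EuclideanSpace ℝ (Fin d)) : ℝ :=
  β (‖u‖ ^ 2 / σ ^ 2)

lemma firstLoss_eq (θ x : EuclideanSpace ℝ (Fin d)) :
    firstLoss d σ β θ x = errorLoss σ β (x - θ) := rfl

lemma measurable_errorLoss (hβ : StrictMonoOn β (Ici 0)) :
    Measurable (errorLoss (d := d) σ β) := by
  -- Nothing is known about `β` on negative arguments, so it is replaced by a globally monotone
  -- extension.
  have hm : Monotone fun t => β (max t 0) := fun a b hab =>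
    hβ.monotoneOn (mem_Ici.2 (le_max_right _ _)) (mem_Ici.2 (le_max_right _ _)) (max_le_max_right 0 hab)
  have h : errorLoss (d := d) σ β =
      fun u => (fun t => β (max t 0)) (‖u‖ ^ 2 / σ ^ 2) := by
    ext u
    simp only [errorLoss]
    rw [max_eq_left (by positivity)]
  rw [h]
  exact hm.measurable.comp (by fun_prop)

lemma errorLoss_pos (hσ : 0 < σ) (hβ_nonneg : ∀ t, 0 ≤ t → 0 ≤ β t)
    (hβ : StrictMonoOn β (Ici 0)) {u : EuclideanSpace ℝ (Fin d)} (hu : u ≠ 0) :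
    0 < errorLoss σ β u := by
  have hpos : 0 < ‖u‖ ^ 2 / σ ^ 2 := by
    have := norm_pos_iff.2 hu
    positivity
  exact (hβ_nonneg 0 le_rfl).trans_lt (hβ self_mem_Ici hpos.le hpos)

/-- The loss can vanish only at `u = 0`, a null set because `d ≥ 1`. -/
lemma ae_errorLoss_pos (hd : 1 ≤ d) (hσ : 0 < σ) (hβ_nonneg : ∀ t, 0 ≤ t → 0 ≤ β t)
    (hβ : StrictMonoOn β (Ici 0)) :
    ∀ᵐ u ∂(normalModel d σ 0), 0 < errorLoss σ β u := by
  have : Nonempty (Fin d) := ⟨⟨0, hd⟩⟩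
  have hac : normalModel d σ 0 ≪ volume := by
    rw [normalModel_zero_eq_withDensity hσ]
    exact withDensity_absolutelyContinuous _ _
  have h : ∀ᵐ u ∂(volume : Measure (EuclideanSpace ℝ (Fin d))), u ≠ 0 := by
    simp [ae_iff]
  filter_upwards [hac.ae_le h] with u hu using errorLoss_pos hσ hβ_nonneg hβ hu

lemma measurable_secondLoss {α : Type*} [MeasurableSpace α] (hρ : Measurable ρ)
    {f g : α → ℝ} (hf : Measurable f) (hg : Measurable g) :
    Measurable fun a => secondLoss ρ (f a) (g a) :=
  (hρ.comp (hg.div hf)).ennreal_ofReal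

lemma risk_eq_lintegral_error (hρ : Measurable ρ) (hβ : StrictMonoOn β (Ici 0))
    {δ : EuclideanSpace ℝ (Fin d) → ℝ} (hδ : Measurable δ) (θ : EuclideanSpace ℝ (Fin d)) :
    risk d σ β ρ δ θ =
      ∫⁻ u, secondLoss ρ (errorLoss σ β u) (δ (θ + u)) ∂(normalModel d σ 0) := by
  rw [risk, normalModel_eq_map_add, lintegral_map _ (by fun_prop)]
  · simp [firstLoss_eq]
  · exact measurable_secondLoss hρ ((measurable_errorLoss hβ).comp (by fun_prop)) hδ

lemma posteriorLoss_eq_lintegral_error (hσ : 0 < σ) (hρ : Measurable ρ)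
    (hβ : StrictMonoOn β (Ici 0)) (x : EuclideanSpace ℝ (Fin d)) (l : ℝ) :
    posteriorLoss d σ β ρ volume x l =
      ∫⁻ u, secondLoss ρ (errorLoss σ β u) l ∂(normalModel d σ 0) := by
  rw [posteriorLoss, posterior_volume hσ, lintegral_map _ (by fun_prop)]
  · simp [firstLoss_eq]
  · exact measurable_secondLoss hρ ((measurable_errorLoss hβ).comp (by fun_prop))
      measurable_const

/-! ### The minimax lower bound by averaging over balls. -/

/-- Averaging the risk over a large ball bounds the maximal risk from below by the least expected
second-stage loss of a constant estimate when the error is restricted to a ball. -/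
lemma le_iSup_risk (hρ : Measurable ρ) (hβ : StrictMonoOn β (Ici 0)) {M : ℝ}
    {r : ℝ≥0∞} (hr : ∀ l, 0 < l → r ≤ ∫⁻ u in Metric.closedBall 0 M,
      secondLoss ρ (errorLoss σ β u) l ∂(normalModel d σ 0))
    {δ : EuclideanSpace ℝ (Fin d) → ℝ} (hδ : IsLossEstimator δ) :
    r ≤ ⨆ θ, risk d σ β ρ δ θ := by
  set S := ⨆ θ, risk d σ β ρ δ θ with hS
  let V := EuclideanSpace ℝ (Fin d)
  have hW : Measurable fun p : V × V => secondLoss ρ (errorLoss σ β p.1) (δ p.2) :=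
    measurable_secondLoss hρ ((measurable_errorLoss hβ).comp measurable_fst)
      (hδ.1.comp measurable_snd)
  have havg : ∀ K, M ≤ K →
      volume (Metric.closedBall (0 : V) (K - M)) * r ≤ volume (Metric.closedBall (0 : V) K) * S := by
    intro K hK
    have hind : Measurable ((Metric.closedBall (0 : V) K).indicator (1 : V → ℝ≥0∞)) :=
      measurable_one.indicator Metric.isClosed_closedBall.measurableSet
    calc volume (Metric.closedBall (0 : V) (K - M)) * r
        = ∫⁻ x in Metric.closedBall (0 : V) (K - M), r := by
          rw [setLIntegral_const, mul_comm]
      _ ≤ ∫⁻ x in Metric.closedBall (0 : V) (K - M), ∫⁻ u,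
            (Metric.closedBall (0 : V) K).indicator 1 (x - u) *
              secondLoss ρ (errorLoss σ β u) (δ x) ∂(normalModel d σ 0) := by
          refine setLIntegral_mono' Metric.isClosed_closedBall.measurableSet fun x hx => ?_
          -- With `x` fixed, `δ x` is a constant estimate; the indicator is 1 since `‖x - u‖ ≤ (K -
          -- M) + M`.
          refine (hr (δ x) (hδ.2 x)).trans ?_
          refine (setLIntegral_mono' Metric.isClosed_closedBall.measurableSet fun u hu => ?_).trans
            (setLIntegral_le_lintegral (Metric.closedBall 0 M) _)
          rw [indicator_of_mem, Pi.one_apply, one_mul]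
          rw [mem_closedBall_zero_iff] at hx hu ⊢
          exact (norm_sub_le _ _).trans (by linarith)
      _ ≤ ∫⁻ x, ∫⁻ u, (Metric.closedBall (0 : V) K).indicator 1 (x - u) *
              secondLoss ρ (errorLoss σ β u) (δ x) ∂(normalModel d σ 0) :=
          setLIntegral_le_lintegral _ _
      _ = ∫⁻ u, (∫⁻ x, (Metric.closedBall (0 : V) K).indicator 1 (x - u) *
              secondLoss ρ (errorLoss σ β u) (δ x)) ∂(normalModel d σ 0) := by
          apply lintegral_lintegral_swap
          exact ((hind.comp (measurable_fst.sub measurable_snd)).mul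
            (hW.comp measurable_swap)).aemeasurable
      _ = ∫⁻ u, (∫⁻ θ, (Metric.closedBall (0 : V) K).indicator 1 θ *
              secondLoss ρ (errorLoss σ β u) (δ (θ + u))) ∂(normalModel d σ 0) := by
          refine lintegral_congr fun u => ?_
          rw [← lintegral_add_right_eq_self _ u]
          simp only [add_sub_cancel_right, V]
      _ = ∫⁻ θ, ∫⁻ u, (Metric.closedBall (0 : V) K).indicator 1 θ *
              secondLoss ρ (errorLoss σ β u) (δ (θ + u)) ∂(normalModel d σ 0) := by
          apply lintegral_lintegral_swap
          exact ((hind.comp measurable_snd).mul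
            (hW.comp (measurable_fst.prodMk (measurable_snd.add measurable_fst)))).aemeasurable
      _ = ∫⁻ θ, (Metric.closedBall (0 : V) K).indicator (risk d σ β ρ δ) θ := by
          refine lintegral_congr fun θ => ?_
          by_cases hθ : θ ∈ Metric.closedBall (0 : V) K
          · simp only [indicator_of_mem hθ, Pi.one_apply, one_mul]
            exact (risk_eq_lintegral_error hρ hβ hδ.1 θ).symm
          · simp [indicator_of_notMem hθ]
      _ ≤ ∫⁻ θ, (Metric.closedBall (0 : V) K).indicator (fun _ => S) θ := by
          refine lintegral_mono fun θ => indicator_le_indicator ?_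
          exact le_iSup (risk d σ β ρ δ) θ
      _ = volume (Metric.closedBall (0 : V) K) * S := by
          rw [lintegral_indicator_const Metric.isClosed_closedBall.measurableSet, mul_comm]
  -- Dividing by the volume of the larger ball, which is positive and finite, leaves the ratio of
  -- volumes.
  have hratio : ∀ᶠ K : ℝ in atTop, ENNReal.ofReal (((K - M) / K) ^ d) * r ≤ S := by
    filter_upwards [eventually_ge_atTop M, eventually_gt_atTop 0] with K hK hK0
    have h := havg K hK
    have hv0 : volume (Metric.closedBall (0 : V) K) ≠ 0 :=
      (Metric.measure_closedBall_pos _ _ hK0).ne'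
    have hvt : volume (Metric.closedBall (0 : V) K) ≠ ∞ := measure_closedBall_lt_top.ne
    have hvol : volume (Metric.closedBall (0 : V) (K - M)) =
        volume (Metric.closedBall (0 : V) K) * ENNReal.ofReal (((K - M) / K) ^ d) := by
      rw [Measure.addHaar_closedBall _ _ (sub_nonneg.2 hK), Measure.addHaar_closedBall _ _ hK0.le,
        mul_right_comm, ← ENNReal.ofReal_mul (by positivity), finrank_euclideanSpace_fin, ← mul_pow,
        mul_div_cancel₀ _ hK0.ne']
    rw [hvol, mul_assoc] at h
    exact (ENNReal.mul_le_mul_iff_right hv0 hvt).1 h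
  have hlim : Tendsto (fun K : ℝ => ENNReal.ofReal (((K - M) / K) ^ d) * r) atTop (𝓝 (1 * r)) := by
    refine ENNReal.Tendsto.mul_const ?_ (Or.inl one_ne_zero)
    rw [← ENNReal.ofReal_one]
    refine ENNReal.tendsto_ofReal ?_
    have h1 : Tendsto (fun K : ℝ => 1 - M / K) atTop (𝓝 (1 - 0)) :=
      tendsto_const_nhds.sub (tendsto_const_nhds.div_atTop tendsto_id)
    have h2 := h1.pow d
    rw [sub_zero, one_pow] at h2
    refine h2.congr' ?_
    filter_upwards [eventually_gt_atTop 0] with K hK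
    rw [sub_div, div_self hK.ne']
  rw [one_mul] at hlim
  exact le_of_tendsto hlim hratio

/-- If the constant `c` is the strict minimizer of the expected second-stage loss, with minimum `r`,
and `r` is the limit of lower bounds for errors restricted to balls, then `c` is the unique
generalized Bayes estimator and is minimax with constant risk `r`. -/
theorem bayes_minimax_of_constant (hσ : 0 < σ) (hρ : Measurable ρ) (hβ : StrictMonoOn β (Ici 0))
    {c r : ℝ} (hc : 0 < c)
    (hmin : ∫⁻ u, secondLoss ρ (errorLoss σ β u) c ∂(normalModel d σ 0) = ENNReal.ofReal r)
    (hstrict : ∀ l, 0 < l → l ≠ c →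
      ENNReal.ofReal r < ∫⁻ u, secondLoss ρ (errorLoss σ β u) l ∂(normalModel d σ 0))
    {s : ℕ → ℝ} (hs : Tendsto s atTop (𝓝 r))
    (hlow : ∀ᶠ n : ℕ in atTop, ∀ l, 0 < l → ENNReal.ofReal (s n) ≤
      ∫⁻ u in Metric.closedBall 0 n, secondLoss ρ (errorLoss σ β u) l ∂(normalModel d σ 0)) :
    (∀ δ, IsGeneralizedBayes d σ β ρ volume δ ↔ δ = fun _ => c) ∧
      (∀ θ, risk d σ β ρ (fun _ => c) θ = ENNReal.ofReal r) ∧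
      IsMinimax d σ β ρ (fun _ => c) ∧
      minimaxRisk d σ β ρ = ENNReal.ofReal r := by
  have hest : IsLossEstimator fun _ : EuclideanSpace ℝ (Fin d) => c :=
    ⟨measurable_const, fun _ => hc⟩
  have hrisk : ∀ θ, risk d σ β ρ (fun _ => c) θ = ENNReal.ofReal r := fun θ => by
    rw [risk_eq_lintegral_error hρ hβ measurable_const, hmin]
  have hsup : ⨆ θ, risk d σ β ρ (fun _ => c) θ = ENNReal.ofReal r := by
    simp [hrisk]
  have hmm : minimaxRisk d σ β ρ = ENNReal.ofReal r := by
    refine le_antisymm ((iInf₂_le _ hest).trans_eq hsup) (le_iInf₂ fun δ hδ => ?_)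
    refine le_of_tendsto (ENNReal.tendsto_ofReal hs) ?_
    filter_upwards [hlow] with n hn
    exact le_iSup_risk hρ hβ hn hδ
  refine ⟨fun δ => ⟨fun h => ?_, ?_⟩, hrisk, ⟨hest, hsup.trans hmm.symm⟩, hmm⟩
  · ext x
    by_contra hne
    have h1 := h.2 x c hc
    rw [posteriorLoss_eq_lintegral_error hσ hρ hβ, posteriorLoss_eq_lintegral_error hσ hρ hβ,
      hmin] at h1
    exact h1.not_gt (hstrict _ (h.1.2 x) hne)
  · rintro rfl
    refine ⟨hest, fun x l hl => ?_⟩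
    rw [posteriorLoss_eq_lintegral_error hσ hρ hβ, posteriorLoss_eq_lintegral_error hσ hρ hβ, hmin]
    rcases eq_or_ne l c with rfl | hne
    · exact hmin.ge
    · exact (hstrict l hl hne).le

/-! ### Quadratic second-stage losses. -/

lemma integral_pos_of_ae_pos {α : Type*} [MeasurableSpace α] {μ : Measure α}
    [IsProbabilityMeasure μ] {f : α → ℝ} (hf : Integrable f μ) (hpos : ∀ᵐ a ∂μ, 0 < f a) :
    0 < ∫ a, f a ∂μ := by
  have hnn : 0 ≤ᵐ[μ] f := hpos.mono fun _ h => h.le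
  refine (integral_nonneg_of_ae hnn).lt_of_ne' fun h0 => ?_
  obtain ⟨a, ha0, ha⟩ := (((integral_eq_zero_iff_of_nonneg_ae hnn hf).1 h0).and hpos).exists
  exact ha.ne' ha0

lemma integral_sq_mul_sub {α : Type*} [MeasurableSpace α] {μ : Measure α} {f g : α → ℝ}
    (hf : MemLp f 2 μ) (hg : MemLp g 2 μ) (a : ℝ) :
    ∫ x, (a * f x - g x) ^ 2 ∂μ =
      a ^ 2 * ∫ x, f x ^ 2 ∂μ - 2 * a * ∫ x, f x * g x ∂μ + ∫ x, g x ^ 2 ∂μ := by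
  have h1 : Integrable (fun x => a ^ 2 * f x ^ 2) μ := hf.integrable_sq.const_mul _
  have h2 : Integrable (fun x => 2 * a * (f x * g x)) μ := (hf.integrable_mul hg).const_mul _
  have h12 : Integrable (fun x => a ^ 2 * f x ^ 2 - 2 * a * (f x * g x)) μ := h1.sub h2
  rw [← integral_const_mul, ← integral_const_mul, ← integral_sub h1 h2,
    ← integral_add h12 hg.integrable_sq]
  congr 1
  ext x
  ring

lemma lintegral_sq_mul_sub {α : Type*} [MeasurableSpace α] {μ : Measure α} {f g : α → ℝ}
    (hf : MemLp f 2 μ) (hg : MemLp g 2 μ) (a : ℝ) :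
    ∫⁻ x, ENNReal.ofReal ((a * f x - g x) ^ 2) ∂μ =
      ENNReal.ofReal (a ^ 2 * ∫ x, f x ^ 2 ∂μ - 2 * a * ∫ x, f x * g x ∂μ + ∫ x, g x ^ 2 ∂μ) := by
  have hint : Integrable (fun x => (a * f x - g x) ^ 2) μ :=
    ((hf.const_mul a).sub hg).integrable_sq
  rw [← integral_sq_mul_sub hf hg,
    ofReal_integral_eq_lintegral_ofReal hint (ae_of_all _ fun x => sq_nonneg _)]

/-- Completing the square exhibits the minimizer `B / A` and the minimum `C - B ^ 2 / A`, both for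
the full error law and for its truncations. -/
lemma quadratic_eq {A B C a : ℝ} (hA : A ≠ 0) :
    a ^ 2 * A - 2 * a * B + C = C - B ^ 2 / A + A * (a - B / A) ^ 2 := by
  field_simp
  ring

lemma tendsto_setIntegral_closedBall {μ : Measure (EuclideanSpace ℝ (Fin d))}
    {f : EuclideanSpace ℝ (Fin d) → ℝ} (hf : Integrable f μ) :
    Tendsto (fun n : ℕ => ∫ u in Metric.closedBall 0 n, f u ∂μ) atTop (𝓝 (∫ u, f u ∂μ)) := by
  have hU : ⋃ n : ℕ, Metric.closedBall (0 : EuclideanSpace ℝ (Fin d)) n = univ :=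
    Metric.iUnion_closedBall_nat 0
  have h := tendsto_setIntegral_of_monotone (μ := μ) (f := f)
    (s := fun n : ℕ => Metric.closedBall (0 : EuclideanSpace ℝ (Fin d)) n)
    (fun n => Metric.isClosed_closedBall.measurableSet)
    (fun m n hmn => Metric.closedBall_subset_closedBall (by exact_mod_cast hmn))
    (by rw [hU]; exact hf.integrableOn)
  rwa [hU, setIntegral_univ] at h

/-- The case of a second-stage loss that is a quadratic function `(φ(l) f(u) - g(u))²` of a
reparametrization `φ(l)` of the estimate. -/
theorem bayes_minimax_of_quadratic (hσ : 0 < σ) (hρ : Measurable ρ) (hβ : StrictMonoOn β (Ici 0))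
    {φ : ℝ → ℝ} (hφ : InjOn φ (Ioi 0)) {f g : EuclideanSpace ℝ (Fin d) → ℝ}
    (hf : MemLp f 2 (normalModel d σ 0)) (hg : MemLp g 2 (normalModel d σ 0))
    (hρfg : ∀ l, 0 < l → ∀ᵐ u ∂(normalModel d σ 0),
      ρ (l / errorLoss σ β u) = (φ l * f u - g u) ^ 2)
    (hfpos : 0 < ∫ u, f u ^ 2 ∂(normalModel d σ 0)) {c r : ℝ} (hc : 0 < c)
    (hφc : φ c = (∫ u, f u * g u ∂(normalModel d σ 0)) / ∫ u, f u ^ 2 ∂(normalModel d σ 0))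
    (hr : r = ∫ u, g u ^ 2 ∂(normalModel d σ 0) -
      (∫ u, f u * g u ∂(normalModel d σ 0)) ^ 2 / ∫ u, f u ^ 2 ∂(normalModel d σ 0)) :
    (∀ δ, IsGeneralizedBayes d σ β ρ volume δ ↔ δ = fun _ => c) ∧
      (∀ θ, risk d σ β ρ (fun _ => c) θ = ENNReal.ofReal r) ∧
      IsMinimax d σ β ρ (fun _ => c) ∧
      minimaxRisk d σ β ρ = ENNReal.ofReal r := by
  set μ := normalModel d σ 0
  set A := ∫ u, f u ^ 2 ∂μ
  set B := ∫ u, f u * g u ∂μ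
  have hloss : ∀ l, 0 < l → ∫⁻ u, secondLoss ρ (errorLoss σ β u) l ∂μ =
      ENNReal.ofReal (r + A * (φ l - φ c) ^ 2) := fun l hl => by
    rw [hr, hφc, ← quadratic_eq hfpos.ne', ← lintegral_sq_mul_sub hf hg]
    refine lintegral_congr_ae ?_
    filter_upwards [hρfg l hl] with u hu
    rw [secondLoss, hu]
  have hr0 : 0 ≤ r := by
    have h : r = ∫ u, (φ c * f u - g u) ^ 2 ∂μ := by
      rw [integral_sq_mul_sub hf hg, quadratic_eq hfpos.ne', hφc, hr]
      ring
    rw [h]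
    exact integral_nonneg fun u => sq_nonneg _
  have hA := tendsto_setIntegral_closedBall hf.integrable_sq
  have hB := tendsto_setIntegral_closedBall (hf.integrable_mul hg)
  have hC := tendsto_setIntegral_closedBall hg.integrable_sq
  refine bayes_minimax_of_constant hσ hρ hβ hc (by simp [μ, hloss c hc]) (fun l hl hne => ?_)
    (hr ▸ hC.sub ((hB.pow 2).div hA hfpos.ne')) ?_
  · rw [hloss l hl]
    have : φ l - φ c ≠ 0 := sub_ne_zero.2 fun h => hne (hφ hl hc h)
    exact (ENNReal.ofReal_lt_ofReal_iff (by positivity)).2 (lt_add_of_pos_right _ (by positivity))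
  -- The square can be completed on the ball only once the truncated second moment of `f` is
  -- positive, hence only for large `n`.
  · filter_upwards [hA.eventually (lt_mem_nhds hfpos)] with n hn l hl
    have heq : ∫⁻ u in Metric.closedBall 0 n, secondLoss ρ (errorLoss σ β u) l ∂μ =
        ∫⁻ u in Metric.closedBall 0 n, ENNReal.ofReal ((φ l * f u - g u) ^ 2) ∂μ := by
      refine lintegral_congr_ae ?_
      filter_upwards [ae_restrict_of_ae (hρfg l hl)] with u hu
      rw [secondLoss, hu]
    rw [heq, lintegral_sq_mul_sub (hf.restrict _) (hg.restrict _), quadratic_eq hn.ne']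
    exact ENNReal.ofReal_le_ofReal (le_add_of_nonneg_right (by positivity))

/-! ### The loss `ρ_B`, through AM-GM. -/

lemma sqrt_mul_le_half {P Q l : ℝ} (hP : 0 ≤ P) (hQ : 0 ≤ Q) (hl : 0 < l) :
    √(P * Q) ≤ 1 / 2 * (l * P + Q / l) := by
  rw [Real.sqrt_le_left (by positivity)]
  have h : P * Q = (l * P) * (Q / l) := by field_simp
  rw [h]
  nlinarith [sq_nonneg (l * P - Q / l)]

/-- Equality in AM-GM forces `l * P = Q / l`, that is `l ^ 2 = Q / P`. -/
lemma sqrt_mul_lt_half {P Q l : ℝ} (hP : 0 < P) (hQ : 0 < Q) (hl : 0 < l) (hne : l ≠ √(Q / P)) :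
    √(P * Q) < 1 / 2 * (l * P + Q / l) := by
  rw [Real.sqrt_lt' (by positivity)]
  have h : P * Q = (l * P) * (Q / l) := by field_simp
  have h2 : l * P - Q / l ≠ 0 := fun h0 => hne <| by
    have : Q / P = l ^ 2 := by
      field_simp at h0 ⊢
      linarith
    rw [this, Real.sqrt_sq hl.le]
  rw [h]
  nlinarith [sq_pos_of_ne_zero h2]

lemma half_mul_sqrt_div {P Q : ℝ} (hP : 0 < P) (hQ : 0 < Q) :
    1 / 2 * (√(Q / P) * P + Q / √(Q / P)) = √(P * Q) := by
  obtain ⟨p, hp, rfl⟩ : ∃ p, 0 < p ∧ P = p ^ 2 := ⟨√P, Real.sqrt_pos.2 hP, (Real.sq_sqrt hP.le).symm⟩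
  obtain ⟨q, hq, rfl⟩ : ∃ q, 0 < q ∧ Q = q ^ 2 := ⟨√Q, Real.sqrt_pos.2 hQ, (Real.sq_sqrt hQ.le).symm⟩
  rw [← div_pow, ← mul_pow, Real.sqrt_sq (by positivity), Real.sqrt_sq (by positivity)]
  field_simp
  ring

lemma rhoB_nonneg {t : ℝ} (ht : 0 < t) : 0 ≤ rhoB t := by
  have h : rhoB t = (t - 1) ^ 2 / (2 * t) := by
    rw [rhoB]
    field_simp
    ring
  rw [h]
  positivity

lemma rhoB_div (l L : ℝ) : rhoB (l / L) = 1 / 2 * (l * (1 / L) + L / l) - 1 := by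
  rw [rhoB, one_div_div]
  ring

lemma integrable_rhoB {α : Type*} [MeasurableSpace α] {μ : Measure α} [IsFiniteMeasure μ]
    {f : α → ℝ} (hf : Integrable f μ) (hf' : Integrable (fun x => 1 / f x) μ) (l : ℝ) :
    Integrable (fun x => rhoB (l / f x)) μ := by
  simp_rw [rhoB_div]
  exact (((hf'.const_mul l).add (hf.div_const l)).const_mul _).sub (integrable_const _)

/-- The total mass is kept general so that the formula also covers the error law restricted to a
ball. -/
lemma integral_rhoB {α : Type*} [MeasurableSpace α] {μ : Measure α} [IsFiniteMeasure μ]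
    {f : α → ℝ} (hf : Integrable f μ) (hf' : Integrable (fun x => 1 / f x) μ) (l : ℝ) :
    ∫ x, rhoB (l / f x) ∂μ =
      1 / 2 * (l * ∫ x, 1 / f x ∂μ + (∫ x, f x ∂μ) / l) - μ.real univ := by
  have h1 : Integrable (fun x => 1 / 2 * (l * (1 / f x) + f x / l)) μ :=
    ((hf'.const_mul l).add (hf.div_const l)).const_mul _
  simp_rw [rhoB_div]
  rw [integral_sub h1 (integrable_const _), integral_const_mul,
    integral_add (hf'.const_mul l) (hf.div_const l), integral_const_mul,
    integral_div, integral_const, smul_eq_mul, mul_one]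

lemma lintegral_rhoB {α : Type*} [MeasurableSpace α] {μ : Measure α} [IsFiniteMeasure μ]
    {f : α → ℝ} (hpos : ∀ᵐ x ∂μ, 0 < f x) (hf : Integrable f μ)
    (hf' : Integrable (fun x => 1 / f x) μ) {l : ℝ} (hl : 0 < l) :
    ∫⁻ x, secondLoss rhoB (f x) l ∂μ =
      ENNReal.ofReal (1 / 2 * (l * ∫ x, 1 / f x ∂μ + (∫ x, f x ∂μ) / l) - μ.real univ) := by
  rw [← integral_rhoB hf hf', ofReal_integral_eq_lintegral_ofReal (integrable_rhoB hf hf' l)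
    (hpos.mono fun x hx => rhoB_nonneg (div_pos hl hx))]
  rfl

lemma measurable_rhoA (m : ℝ) : Measurable (rhoA m) := by
  unfold rhoA
  fun_prop

lemma measurable_rhoB : Measurable rhoB := by
  unfold rhoB
  fun_prop

lemma measurable_rhoC : Measurable rhoC := by
  unfold rhoC
  fun_prop

theorem bayes_minimax_rhoB (hσ : 0 < σ) (hβ : StrictMonoOn β (Ici 0))
    (hpos : ∀ᵐ u ∂(normalModel d σ 0), 0 < errorLoss σ β u)
    (hint : Integrable (errorLoss σ β) (normalModel d σ 0))
    (hint' : Integrable (fun u => 1 / errorLoss σ β u) (normalModel d σ 0)) {c r : ℝ}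
    (hc : c = √((∫ u, errorLoss σ β u ∂(normalModel d σ 0)) /
      ∫ u, 1 / errorLoss σ β u ∂(normalModel d σ 0)))
    (hr : r = √((∫ u, errorLoss σ β u ∂(normalModel d σ 0)) *
      ∫ u, 1 / errorLoss σ β u ∂(normalModel d σ 0)) - 1) :
    (∀ δ, IsGeneralizedBayes d σ β rhoB volume δ ↔ δ = fun _ => c) ∧
      (∀ θ, risk d σ β rhoB (fun _ => c) θ = ENNReal.ofReal r) ∧
      IsMinimax d σ β rhoB (fun _ => c) ∧
      minimaxRisk d σ β rhoB = ENNReal.ofReal r := by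
  set μ := normalModel d σ 0
  set Q := ∫ u, errorLoss σ β u ∂μ
  set P := ∫ u, 1 / errorLoss σ β u ∂μ
  have hQ : 0 < Q := integral_pos_of_ae_pos hint hpos
  have hP : 0 < P := integral_pos_of_ae_pos hint' (hpos.mono fun u hu => one_div_pos.2 hu)
  rw [mul_comm] at hr
  have hc0 : 0 < c := hc ▸ Real.sqrt_pos.2 (div_pos hQ hP)
  have hr0 : 0 ≤ r := by
    have h := integral_rhoB hint hint' c
    rw [probReal_univ, hc, half_mul_sqrt_div hP hQ, ← hr, ← hc] at h
    rw [← h]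
    exact integral_nonneg_of_ae (hpos.mono fun u hu => rhoB_nonneg (div_pos hc0 hu))
  -- The truncated lower bound subtracts the mass of the ball, not 1.
  have hone : Tendsto (fun n : ℕ => ∫ _u in Metric.closedBall 0 n, (1 : ℝ) ∂μ) atTop (𝓝 1) := by
    simpa using tendsto_setIntegral_closedBall (integrable_const (μ := μ) (1 : ℝ))
  refine bayes_minimax_of_constant hσ measurable_rhoB hβ hc0 ?_ (fun l hl hne => ?_)
    (hr ▸ (((tendsto_setIntegral_closedBall hint').mul
      (tendsto_setIntegral_closedBall hint)).sqrt.sub hone)) ?_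
  · rw [lintegral_rhoB hpos hint hint' hc0, probReal_univ, hc, half_mul_sqrt_div hP hQ, hr]
  · rw [lintegral_rhoB hpos hint hint' hl, probReal_univ, hr]
    have h := sqrt_mul_lt_half hP hQ hl (hc ▸ hne)
    exact (ENNReal.ofReal_lt_ofReal_iff (by linarith)).2 (sub_lt_sub_right h 1)
  · refine Eventually.of_forall fun n l hl => ?_
    have hpos' := ae_restrict_of_ae (s := Metric.closedBall 0 (n : ℝ)) hpos
    rw [lintegral_rhoB hpos' hint.restrict hint'.restrict hl]
    refine ENNReal.ofReal_le_ofReal (sub_le_sub (sqrt_mul_le_half ?_ ?_ hl) (by simp))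
    · exact integral_nonneg_of_ae (hpos'.mono fun u hu => (one_div_pos.2 hu).le)
    · exact integral_nonneg_of_ae (hpos'.mono fun u hu => hu.le)

/-! ### Transfer from the chi-square law, and the losses `ρ_A` and `ρ_C`. -/

instance isProbabilityMeasure_chiSquare : IsProbabilityMeasure (chiSquare d) := by
  unfold chiSquare
  exact Measure.isProbabilityMeasure_map (by fun_prop)

lemma integral_chiSquare (hσ : 0 < σ) {F : ℝ → ℝ} (hF : AEStronglyMeasurable F (chiSquare d)) :
    ∫ z, F z ∂(chiSquare d) = ∫ u, F (‖u‖ ^ 2 / σ ^ 2) ∂(normalModel d σ 0) := by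
  rw [chiSquare_eq_map hσ] at hF ⊢
  exact integral_map (by fun_prop) hF

lemma measurePreserving_chiSquare (hσ : 0 < σ) :
    MeasurePreserving (fun u : EuclideanSpace ℝ (Fin d) => ‖u‖ ^ 2 / σ ^ 2) (normalModel d σ 0)
      (chiSquare d) :=
  ⟨by fun_prop, (chiSquare_eq_map hσ).symm⟩

lemma integrable_comp_of_chiSquare (hσ : 0 < σ) {F : ℝ → ℝ} (hF : Integrable F (chiSquare d)) :
    Integrable (fun u : EuclideanSpace ℝ (Fin d) => F (‖u‖ ^ 2 / σ ^ 2)) (normalModel d σ 0) :=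
  (measurePreserving_chiSquare hσ).integrable_comp_of_integrable hF

/-- Quadratic in `l ^ m`: the loss is `(l ^ m * L ^ (-m) - 1) ^ 2`. -/
theorem bayes_minimax_rhoA (hσ : 0 < σ) (hβ : StrictMonoOn β (Ici 0))
    (hpos : ∀ᵐ u ∂(normalModel d σ 0), 0 < errorLoss σ β u) {m : ℝ} (hm : m ≠ 0)
    (hint : Integrable (fun u => errorLoss σ β u ^ (-2 * m)) (normalModel d σ 0)) {c r : ℝ}
    (hc : c = ((∫ u, errorLoss σ β u ^ (-m) ∂(normalModel d σ 0)) /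
      ∫ u, errorLoss σ β u ^ (-2 * m) ∂(normalModel d σ 0)) ^ (1 / m))
    (hr : r = 1 - (∫ u, errorLoss σ β u ^ (-m) ∂(normalModel d σ 0)) ^ 2 /
      ∫ u, errorLoss σ β u ^ (-2 * m) ∂(normalModel d σ 0)) :
    (∀ δ, IsGeneralizedBayes d σ β (rhoA m) volume δ ↔ δ = fun _ => c) ∧
      (∀ θ, risk d σ β (rhoA m) (fun _ => c) θ = ENNReal.ofReal r) ∧
      IsMinimax d σ β (rhoA m) (fun _ => c) ∧
      minimaxRisk d σ β (rhoA m) = ENNReal.ofReal r := by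
  set μ := normalModel d σ 0
  have hmeas : Measurable fun u : EuclideanSpace ℝ (Fin d) => errorLoss σ β u ^ (-m) :=
    (measurable_errorLoss hβ).pow_const _
  have hsq : (fun u : EuclideanSpace ℝ (Fin d) => (errorLoss σ β u ^ (-m)) ^ 2) =ᵐ[μ]
      fun u => errorLoss σ β u ^ (-2 * m) := by
    filter_upwards [hpos] with u hu
    rw [← Real.rpow_mul_natCast hu.le]
    congr 1
    push_cast
    ring
  have hL2 : MemLp (fun u => errorLoss σ β u ^ (-m)) 2 μ :=
    (memLp_two_iff_integrable_sq hmeas.aestronglyMeasurable).2 (hint.congr hsq.symm)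
  have hB : 0 < ∫ u, errorLoss σ β u ^ (-m) ∂μ :=
    integral_pos_of_ae_pos (hL2.integrable one_le_two) (hpos.mono fun u hu => Real.rpow_pos_of_pos hu _)
  have hA : 0 < ∫ u, errorLoss σ β u ^ (-2 * m) ∂μ :=
    integral_pos_of_ae_pos hint (hpos.mono fun u hu => Real.rpow_pos_of_pos hu _)
  have hAeq := integral_congr_ae hsq
  refine bayes_minimax_of_quadratic hσ (measurable_rhoA m) hβ (φ := fun l => l ^ m)
    (f := fun u => errorLoss σ β u ^ (-m)) (g := fun _ => 1) ?_ hL2 (memLp_const 1) ?_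
    (hAeq ▸ hA) (hc ▸ Real.rpow_pos_of_pos (div_pos hB hA) _) ?_ ?_
  · intro a ha b hb hab
    exact (Real.rpow_left_inj (le_of_lt ha) (le_of_lt hb) hm).1 hab
  · intro l hl
    filter_upwards [hpos] with u hu
    rw [rhoA, Real.div_rpow hl.le hu.le, Real.rpow_neg hu.le, div_eq_mul_inv]
  · simp only [mul_one]
    rw [hAeq, hc, ← Real.rpow_mul (div_pos hB hA).le, one_div_mul_cancel hm, Real.rpow_one]
  · simp only [mul_one, one_pow]
    rw [hAeq, hr]
    simp [μ]

/-- Quadratic in `log l` with `f = 1` and `g = log L`: the best constant approximation of `log L` in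
`L²` is its mean, with error its variance. -/
theorem bayes_minimax_rhoC (hσ : 0 < σ) (hβ : StrictMonoOn β (Ici 0))
    (hpos : ∀ᵐ u ∂(normalModel d σ 0), 0 < errorLoss σ β u)
    (hL2 : MemLp (fun u => Real.log (errorLoss σ β u)) 2 (normalModel d σ 0)) {c r : ℝ}
    (hc : c = Real.exp (∫ u, Real.log (errorLoss σ β u) ∂(normalModel d σ 0)))
    (hr : r = variance (fun u => Real.log (errorLoss σ β u)) (normalModel d σ 0)) :
    (∀ δ, IsGeneralizedBayes d σ β rhoC volume δ ↔ δ = fun _ => c) ∧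
      (∀ θ, risk d σ β rhoC (fun _ => c) θ = ENNReal.ofReal r) ∧
      IsMinimax d σ β rhoC (fun _ => c) ∧
      minimaxRisk d σ β rhoC = ENNReal.ofReal r := by
  refine bayes_minimax_of_quadratic hσ measurable_rhoC hβ Real.log_injOn_pos
    (f := fun _ => 1) (memLp_const 1) hL2 ?_ (by simp) (hc ▸ Real.exp_pos _) ?_ ?_
  · intro l hl
    filter_upwards [hpos] with u hu
    rw [rhoC, Real.log_div hl.ne' hu.ne', mul_one]
  · simp [hc]
  · rw [hr, variance_eq_sub hL2]
    simp

end LossEstimation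

/-- Here `Z ∼ χ²_d`, expectations of functions of `Z` are integrals against `chiSquare d`, and
`volume` is the uniform prior `π₀(θ) = 1`. In each of the three cases the generalized Bayes
estimator exists, is unique and is the stated constant, has constant frequentist risk, and is
minimax. -/
theorem theorem4p2 (d : ℕ) (hd : 1 ≤ d) (σ : ℝ) (hσ : 0 < σ) (β : ℝ → ℝ)
    (hβ_nonneg : ∀ t, 0 ≤ t → 0 ≤ β t)
    (hβ_mono : StrictMonoOn β (Ici 0))
    (hβ_ac : ∀ b, 0 ≤ b → AbsolutelyContinuousOnInterval β 0 b)
    (hβ_int : Integrable β (LossEstimation.chiSquare d)) :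
    -- the loss `ρ_A`
    (∀ m : ℝ, m ≠ 0 →
      Integrable (fun z => β z ^ (-2 * m)) (LossEstimation.chiSquare d) →
      ∀ c r : ℝ,
        c = ((∫ z, β z ^ (-m) ∂(LossEstimation.chiSquare d)) /
              ∫ z, β z ^ (-2 * m) ∂(LossEstimation.chiSquare d)) ^ (1 / m) →
        r = 1 - (∫ z, β z ^ (-m) ∂(LossEstimation.chiSquare d)) ^ 2 /
              ∫ z, β z ^ (-2 * m) ∂(LossEstimation.chiSquare d) →
        (∀ δ, LossEstimation.IsGeneralizedBayes d σ β (LossEstimation.rhoA m) volume δ ↔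
            δ = fun _ => c) ∧
          (∀ θ, LossEstimation.risk d σ β (LossEstimation.rhoA m) (fun _ => c) θ =
            ENNReal.ofReal r) ∧
          LossEstimation.IsMinimax d σ β (LossEstimation.rhoA m) (fun _ => c) ∧
          LossEstimation.minimaxRisk d σ β (LossEstimation.rhoA m) = ENNReal.ofReal r) ∧
    -- the loss `ρ_B`
    (Integrable (fun z => 1 / β z) (LossEstimation.chiSquare d) →
      ∀ c r : ℝ,
        c = √((∫ z, β z ∂(LossEstimation.chiSquare d)) /
              ∫ z, 1 / β z ∂(LossEstimation.chiSquare d)) →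
        r = √((∫ z, β z ∂(LossEstimation.chiSquare d)) *
              ∫ z, 1 / β z ∂(LossEstimation.chiSquare d)) - 1 →
        (∀ δ, LossEstimation.IsGeneralizedBayes d σ β LossEstimation.rhoB volume δ ↔
            δ = fun _ => c) ∧
          (∀ θ, LossEstimation.risk d σ β LossEstimation.rhoB (fun _ => c) θ =
            ENNReal.ofReal r) ∧
          LossEstimation.IsMinimax d σ β LossEstimation.rhoB (fun _ => c) ∧
          LossEstimation.minimaxRisk d σ β LossEstimation.rhoB = ENNReal.ofReal r) ∧
    -- the loss `ρ_C`
    (MemLp (fun z => Real.log (β z)) 2 (LossEstimation.chiSquare d) →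
      ∀ c r : ℝ,
        c = Real.exp (∫ z, Real.log (β z) ∂(LossEstimation.chiSquare d)) →
        r = variance (fun z => Real.log (β z)) (LossEstimation.chiSquare d) →
        (∀ δ, LossEstimation.IsGeneralizedBayes d σ β LossEstimation.rhoC volume δ ↔
            δ = fun _ => c) ∧
          (∀ θ, LossEstimation.risk d σ β LossEstimation.rhoC (fun _ => c) θ =
            ENNReal.ofReal r) ∧
          LossEstimation.IsMinimax d σ β LossEstimation.rhoC (fun _ => c) ∧
          LossEstimation.minimaxRisk d σ β LossEstimation.rhoC = ENNReal.ofReal r) := by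
  have hpos := LossEstimation.ae_errorLoss_pos hd hσ hβ_nonneg hβ_mono
  have hβ_meas := hβ_int.aemeasurable
  have hmp := LossEstimation.measurePreserving_chiSquare (d := d) hσ
  refine ⟨fun m hm hint c r hc hr => ?_, fun hint c r hc hr => ?_, fun hL2 c r hc hr => ?_⟩
  · have hmeas : AEStronglyMeasurable (fun z => β z ^ (-m)) (LossEstimation.chiSquare d) :=
      (hβ_meas.pow_const _).aestronglyMeasurable
    rw [LossEstimation.integral_chiSquare hσ hmeas,
      LossEstimation.integral_chiSquare hσ hint.aestronglyMeasurable] at hc hr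
    exact LossEstimation.bayes_minimax_rhoA hσ hβ_mono hpos hm
      (LossEstimation.integrable_comp_of_chiSquare hσ hint) hc hr
  · rw [LossEstimation.integral_chiSquare hσ hβ_int.aestronglyMeasurable,
      LossEstimation.integral_chiSquare hσ hint.aestronglyMeasurable] at hc hr
    exact LossEstimation.bayes_minimax_rhoB hσ hβ_mono hpos
      (LossEstimation.integrable_comp_of_chiSquare hσ hβ_int)
      (LossEstimation.integrable_comp_of_chiSquare hσ hint) hc hr
  · rw [LossEstimation.integral_chiSquare hσ hL2.aestronglyMeasurable] at hc
    refine LossEstimation.bayes_minimax_rhoC hσ hβ_mono hpos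
      (hL2.comp_measurePreserving hmp) hc ?_
    rw [hr, ← hmp.map_eq, variance_map (hmp.map_eq ▸ hL2.aestronglyMeasurable.aemeasurable)
      hmp.measurable.aemeasurable]
    rfl
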